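/- Let $Z, Z_1, Z_2, \ldots$ be identically distributed random vectors in $\mathbb{R}^2$ with $Z_1, Z_2, \ldots$ independent, and let $S_0 := 0$ and $S_n := \sum_{k=1}^n Z_k$ for $n \ge 1$. Let $D_n$ be the diameter, for the Euclidean distance, of the convex hull of $\{S_0, S_1, \ldots, S_n\}$ (equivalently, of the set $\{S_0, S_1, \ldots, S_n\}$ itself). Suppose that $\mathbb{E}(\|Z\|^2) < \infty$ and that $\mu := \mathbb{E} Z \neq 0$, and put $\hat\mu := \mu / \|\mu\|$. Then, as $n \to \infty$, \[ n^{-1/2} \, | D_n - S_n \cdot \hat\mu | \to 0 \quad \text{in } L^2 , \] that is, these random variables are square-integrable and $n^{-1}\, \mathbb{E}\big[ ( D_n - S_n \cdot \hat\mu )^2 \big] \to 0$. -/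

import Mathlib

open MeasureTheory ProbabilityTheory Filter Topology

/-- The Euclidean plane. -/
abbrev Plane : Type := EuclideanSpace ℝ (Fin 2)

/-- The walk `S n = ∑_{k < n} X k` driven by the increments `X 0, X 1, …` (so `X k` is the
`(k+1)`-st increment `Z_{k+1}`), started at the origin `S 0 = 0`. -/
noncomputable def walk {Ω : Type*} (X : ℕ → Ω → Plane) (n : ℕ) (ω : Ω) : Plane :=
  ∑ k ∈ Finset.range n, X k ω

/-- The convex hull of `S 0, S 1, …, S n`. -/
def walkHull {Ω : Type*} (X : ℕ → Ω → Plane) (n : ℕ) (ω : Ω) : Set Plane :=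
  convexHull ℝ ((fun k => walk X k ω) '' Set.Iic n)

/-- The diameter of the convex hull of the first `n` steps of the walk. -/
noncomputable def walkDiam {Ω : Type*} (X : ℕ → Ω → Plane) (n : ℕ) (ω : Ω) : ℝ :=
  Metric.diam (walkHull X n ω)

/-- The diameter of the hull is the diameter of the set `{S 0, S 1, …, S n}`. -/
theorem walkDiam_eq {Ω : Type*} (X : ℕ → Ω → Plane) (n : ℕ) (ω : Ω) :
    walkDiam X n ω = Metric.diam ((fun k => walk X k ω) '' Set.Iic n) :=
  convexHull_diam _

/-- The unit vector `x / ‖x‖` in the direction of a non-zero vector `x`. -/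
noncomputable def unitDir (x : Plane) : Plane := ‖x‖⁻¹ • x

/-! Put u for the unit vector of the mean. Since S_0 and S_n lie in the hull, D_n - S_n · u is
nonnegative, so only an upper bound with o(n) second moment is needed. Split the path into
coordinates x along u and y along `rotate u`. The spread of x exceeds x_n only by what the path does
behind 0 and beyond x_n. The spread of y is of order √n, while x grows linearly, so in a long chord
y adds little length.

Both effects are measured by reflected walks, i.e. maxima of sums of the last increments, in fixed
directions (`dist_sum_range_le`). Directions `-u` and `±rotate u - δ • u` have negative drift, and
there the second moment is o(n) (`exists_forall_integral_reflectedWalk_sq_le`). Directions `±rotate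
u` have zero drift and second moment O(n) (`integral_reflectedWalk_sq_le`), but enter with a factor
δ. Hence the limsup of the normalised second moment is O(δ²), with δ arbitrary.

For negative drift, the increment is truncated above. The truncated part has bounded exponential
moments; the centred remainder has small variance. -/

/-! ### Reflected walks: pathwise bounds -/

/-- The walk with increments `z 0, z 1, …` reflected at `0` (Lindley's recursion). -/
def reflectedWalk (z : ℕ → ℝ) : ℕ → ℝ
  | 0 => 0
  | n + 1 => max 0 (reflectedWalk z n + z n)

theorem reflectedWalk_nonneg (z : ℕ → ℝ) (n : ℕ) : 0 ≤ reflectedWalk z n := by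
  cases n with
  | zero => exact le_rfl
  | succ n => exact le_max_left _ _

/-- Unrolled, the recursion is the maximum of these sums over k; only this half is needed. -/
theorem sum_Ico_le_reflectedWalk (z : ℕ → ℝ) {k n : ℕ} (hkn : k ≤ n) :
    ∑ i ∈ Finset.Ico k n, z i ≤ reflectedWalk z n := by
  induction n, hkn using Nat.le_induction with
  | base => simpa using reflectedWalk_nonneg z k
  | succ n hkn ih =>
    rw [Finset.sum_Ico_succ_top hkn]
    exact le_trans (by linarith) (le_max_right _ _)

theorem reflectedWalk_add_le (z w : ℕ → ℝ) (n : ℕ) :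
    reflectedWalk (fun i => z i + w i) n ≤ reflectedWalk z n + reflectedWalk w n := by
  induction n with
  | zero => simp [reflectedWalk]
  | succ n ih =>
    simp only [reflectedWalk]
    have h1 := le_max_left 0 (reflectedWalk z n + z n)
    have h2 := le_max_right 0 (reflectedWalk z n + z n)
    have h3 := le_max_left 0 (reflectedWalk w n + w n)
    have h4 := le_max_right 0 (reflectedWalk w n + w n)
    exact max_le (by linarith) (by linarith)

theorem reflectedWalk_le_mul {z : ℕ → ℝ} {K : ℝ} (hK : 0 ≤ K) (hz : ∀ i, z i ≤ K) (n : ℕ) :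
    reflectedWalk z n ≤ n * K := by
  induction n with
  | zero => simp [reflectedWalk]
  | succ n ih =>
    refine max_le (by positivity) ?_
    have := hz n
    push_cast
    linarith

theorem reflectedWalk_congr {z w : ℕ → ℝ} {n : ℕ} (h : ∀ i < n, z i = w i) :
    reflectedWalk z n = reflectedWalk w n := by
  induction n with
  | zero => rfl
  | succ n ih =>
    simp only [reflectedWalk, ih fun i hi => h i (by omega), h n (by omega)]

/-! ### Moments of reflected walks -/

section Probability

variable {Ω : Type*} [MeasurableSpace Ω] {P : Measure Ω}

theorem measurable_reflectedWalk {α : Type*} [MeasurableSpace α] {z : ℕ → α → ℝ}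
    (hz : ∀ i, Measurable (z i)) (n : ℕ) :
    Measurable fun a => reflectedWalk (fun i => z i a) n := by
  induction n with
  | zero => exact measurable_const
  | succ n ih => exact measurable_const.max (ih.add (hz n))

theorem aemeasurable_reflectedWalk {z : ℕ → Ω → ℝ} (hz : ∀ i, AEMeasurable (z i) P) (n : ℕ) :
    AEMeasurable (fun ω => reflectedWalk (fun i => z i ω) n) P := by
  induction n with
  | zero => exact aemeasurable_const
  | succ n ih => exact aemeasurable_const.max (ih.add (hz n))

theorem indepFun_reflectedWalk {z : ℕ → Ω → ℝ} (hind : iIndepFun z P)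
    (hz : ∀ i, AEMeasurable (z i) P) (n : ℕ) :
    IndepFun (fun ω => reflectedWalk (fun i => z i ω) n) (z n) P := by
  have h := hind.indepFun_finset₀ (Finset.range n) {n} (by simp) hz
  -- The padding by 0 is harmless: the value at time n only involves the increments before n.
  let φ : (Finset.range n → ℝ) → ℝ := fun w =>
    reflectedWalk (fun i => if hi : i ∈ Finset.range n then w ⟨i, hi⟩ else 0) n
  have hφ : Measurable φ := by
    refine measurable_reflectedWalk (z := fun i (w : Finset.range n → ℝ) =>
      if hi : i ∈ Finset.range n then w ⟨i, hi⟩ else 0) (fun i => ?_) n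
    by_cases hi : i ∈ Finset.range n
    · simpa only [hi, dite_true] using measurable_pi_apply _
    · simp only [hi, dite_false, measurable_const]
  have h' : IndepFun (fun ω => φ fun i => z i ω) (z n) P :=
    h.comp hφ (measurable_pi_apply (⟨n, by simp⟩ : ({n} : Finset ℕ)))
  convert h' using 1
  ext ω
  refine reflectedWalk_congr fun i hi => ?_
  simp [hi]

theorem memLp_reflectedWalk [IsFiniteMeasure P] {z : ℕ → Ω → ℝ} (hz : ∀ i, MemLp (z i) 2 P)
    (n : ℕ) : MemLp (fun ω => reflectedWalk (fun i => z i ω) n) 2 P := by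
  induction n with
  | zero => exact memLp_const 0
  | succ n ih => exact (memLp_const (0 : ℝ)).sup (ih.add (hz n))

/-- A reflected walk with independent increments of nonpositive mean has second moment at most
the sum of those of its increments. -/
theorem integral_reflectedWalk_sq_le [IsProbabilityMeasure P] {z : ℕ → Ω → ℝ}
    (hind : iIndepFun z P) (hz : ∀ i, MemLp (z i) 2 P) (hmean : ∀ i, ∫ ω, z i ω ∂P ≤ 0)
    {v : ℝ} (hv : ∀ i, ∫ ω, z i ω ^ 2 ∂P ≤ v) (n : ℕ) :
    ∫ ω, reflectedWalk (fun i => z i ω) n ^ 2 ∂P ≤ n * v := by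
  induction n with
  | zero => simp [reflectedWalk]
  | succ n ih =>
    set L : Ω → ℝ := fun ω => reflectedWalk (fun i => z i ω) n with hL
    have hLm : MemLp L 2 P := memLp_reflectedWalk hz n
    have hindep : IndepFun L (z n) P := indepFun_reflectedWalk hind (fun i => (hz i).aemeasurable) n
    have hprod : ∫ ω, L ω * z n ω ∂P = (∫ ω, L ω ∂P) * ∫ ω, z n ω ∂P :=
      hindep.integral_fun_mul_eq_mul_integral hLm.aestronglyMeasurable (hz n).aestronglyMeasurable
    -- The cross term can be dropped: reflection makes `L` nonnegative, and the independent
    -- increment has nonpositive mean.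
    have hneg : ∫ ω, L ω * z n ω ∂P ≤ 0 := by
      rw [hprod]
      exact mul_nonpos_of_nonneg_of_nonpos
        (integral_nonneg fun ω => reflectedWalk_nonneg _ _) (hmean n)
    have hi1 : Integrable (fun ω => L ω ^ 2) P := hLm.integrable_sq
    have hi2 : Integrable (fun ω => 2 * (L ω * z n ω)) P := (hLm.integrable_mul (hz n)).const_mul 2
    have hi3 : Integrable (fun ω => z n ω ^ 2) P := (hz n).integrable_sq
    calc ∫ ω, reflectedWalk (fun i => z i ω) (n + 1) ^ 2 ∂P
        ≤ ∫ ω, (L ω ^ 2 + 2 * (L ω * z n ω) + z n ω ^ 2) ∂P := by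
          refine integral_mono (memLp_reflectedWalk hz (n + 1)).integrable_sq
            ((hi1.add hi2).add hi3) fun ω => ?_
          change max 0 (L ω + z n ω) ^ 2 ≤ _
          rcases max_cases 0 (L ω + z n ω) with h | h <;> rw [h.1] <;>
            nlinarith [sq_nonneg (L ω + z n ω)]
      _ = ∫ ω, L ω ^ 2 ∂P + 2 * ∫ ω, L ω * z n ω ∂P + ∫ ω, z n ω ^ 2 ∂P := by
          rw [integral_add (f := fun ω => L ω ^ 2 + 2 * (L ω * z n ω)) (hi1.add hi2) hi3,
            integral_add hi1 hi2, integral_const_mul]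
      _ ≤ (n + 1 : ℕ) * v := by
          have := hv n
          push_cast
          linarith

/-- From exp (max 0 y) ≤ 1 + exp y and independence, the exponential moments satisfy a_{n+1} ≤ 1 + ρ
a_n, so they stay below the fixed point of this recursion. -/
theorem integral_exp_reflectedWalk_le [IsProbabilityMeasure P] {z : ℕ → Ω → ℝ}
    (hind : iIndepFun z P) (hz : ∀ i, AEMeasurable (z i) P) {K : ℝ} (hK : 0 ≤ K)
    (hzK : ∀ i ω, z i ω ≤ K) {θ ρ : ℝ} (hθ : 0 ≤ θ) (hρ : ρ < 1)
    (hexp : ∀ i, ∫ ω, Real.exp (θ * z i ω) ∂P ≤ ρ) (n : ℕ) :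
    Integrable (fun ω => Real.exp (θ * reflectedWalk (fun i => z i ω) n)) P ∧
    ∫ ω, Real.exp (θ * reflectedWalk (fun i => z i ω) n) ∂P ≤ (1 - ρ)⁻¹ := by
  have hρ0 : 0 ≤ ρ := (integral_nonneg fun ω => (Real.exp_pos _).le).trans (hexp 0)
  have hint : ∀ (f : Ω → ℝ) (C : ℝ), AEMeasurable f P → (∀ ω, f ω ≤ C) →
      Integrable (fun ω => Real.exp (θ * f ω)) P := fun f C hf hC => by
    refine Integrable.of_bound (Real.measurable_exp.comp_aemeasurable
      (hf.const_mul θ)).aestronglyMeasurable (Real.exp (θ * C)) (Eventually.of_forall fun ω => ?_)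
    rw [Real.norm_eq_abs, abs_of_pos (Real.exp_pos _)]
    exact Real.exp_le_exp.2 (mul_le_mul_of_nonneg_left (hC ω) hθ)
  have hI : ∀ n : ℕ, Integrable (fun ω => Real.exp (θ * reflectedWalk (fun i => z i ω) n)) P :=
    fun n => hint _ (n * K) (aemeasurable_reflectedWalk hz n)
      fun ω => reflectedWalk_le_mul hK (fun i => hzK i ω) n
  refine ⟨hI n, ?_⟩
  have h1 : (1 - ρ)⁻¹ * (1 - ρ) = 1 := inv_mul_cancel₀ (by linarith)
  induction n with
  | zero =>
    have : 1 ≤ (1 - ρ)⁻¹ := (one_le_inv₀ (by linarith)).2 (by linarith)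
    simpa [reflectedWalk] using this
  | succ n ih =>
    set L : Ω → ℝ := fun ω => reflectedWalk (fun i => z i ω) n with hL
    have hm : Measurable fun x : ℝ => Real.exp (θ * x) := by fun_prop
    have hindep := (indepFun_reflectedWalk hind hz n).comp hm hm
    have hzI : Integrable (fun ω => Real.exp (θ * z n ω)) P := hint _ K (hz n) (hzK n)
    have hprod : ∫ ω, Real.exp (θ * L ω) * Real.exp (θ * z n ω) ∂P
        = (∫ ω, Real.exp (θ * L ω) ∂P) * ∫ ω, Real.exp (θ * z n ω) ∂P :=
      hindep.integral_fun_mul_eq_mul_integral (hI n).aestronglyMeasurable hzI.aestronglyMeasurable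
    have hprodI : Integrable (fun ω => Real.exp (θ * L ω) * Real.exp (θ * z n ω)) P :=
      hindep.integrable_mul (hI n) hzI
    calc ∫ ω, Real.exp (θ * reflectedWalk (fun i => z i ω) (n + 1)) ∂P
        ≤ ∫ ω, (1 + Real.exp (θ * L ω) * Real.exp (θ * z n ω)) ∂P := by
          refine integral_mono (hI (n + 1)) ((integrable_const _).add hprodI) fun ω => ?_
          change Real.exp (θ * max 0 (L ω + z n ω)) ≤ 1 + _
          rw [← Real.exp_add, ← mul_add]
          have := Real.exp_pos (θ * (L ω + z n ω))
          rcases max_cases 0 (L ω + z n ω) with h | h <;> rw [h.1]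
          · simp [this.le]
          · linarith
      _ = 1 + (∫ ω, Real.exp (θ * L ω) ∂P) * ∫ ω, Real.exp (θ * z n ω) ∂P := by
          rw [integral_add (integrable_const _) hprodI, hprod]
          simp
      _ ≤ 1 + (1 - ρ)⁻¹ * ρ := by
          have h0 : 0 ≤ ∫ ω, Real.exp (θ * z n ω) ∂P := integral_nonneg fun ω => (Real.exp_pos _).le
          have := hexp n
          gcongr
      _ = (1 - ρ)⁻¹ := by linarith

end Probability

/-! ### Negative drift: second moment o(n) -/

theorem exp_le_one_add_add_sq {x : ℝ} (hx : x ≤ 1) : Real.exp x ≤ 1 + x + x ^ 2 := by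
  rcases le_total (-1) x with h | h
  · have := (abs_le.1 (Real.abs_exp_sub_one_sub_id_le (abs_le.2 ⟨h, hx⟩))).2
    linarith
  · have := Real.exp_le_one_iff.2 (by linarith : x ≤ 0)
    nlinarith

section Probability

variable {Ω : Type*} [MeasurableSpace Ω] {P : Measure Ω}

theorem exists_pos_integral_exp_lt_one [IsProbabilityMeasure P] {u : Ω → ℝ} (hu : MemLp u 2 P)
    {K : ℝ} (hK : 0 ≤ K) (huK : ∀ ω, u ω ≤ K) (hneg : ∫ ω, u ω ∂P < 0) :
    ∃ θ : ℝ, 0 < θ ∧ ∫ ω, Real.exp (θ * u ω) ∂P < 1 := by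
  set d := -∫ ω, u ω ∂P with hd
  set V := ∫ ω, u ω ^ 2 ∂P with hV
  have hd0 : 0 < d := by linarith
  have hV0 : 0 ≤ V := integral_nonneg fun ω => sq_nonneg _
  -- The first bound keeps θu ≤ 1, so the quadratic bound on exp applies; the second makes θ²V
  -- smaller than θd.
  refine ⟨min (1 / (K + 1)) (d / (2 * (V + 1))), by positivity, ?_⟩
  set θ := min (1 / (K + 1)) (d / (2 * (V + 1))) with hθ
  have hθ0 : 0 < θ := by positivity
  have h1 : θ * (K + 1) ≤ 1 := (le_div_iff₀ (by positivity)).1 (min_le_left _ _)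
  have h2 : θ * (2 * (V + 1)) ≤ d := (le_div_iff₀ (by positivity)).1 (min_le_right _ _)
  have hle : ∀ ω, Real.exp (θ * u ω) ≤ 1 + θ * u ω + θ ^ 2 * u ω ^ 2 := fun ω => by
    have := mul_le_mul_of_nonneg_left (huK ω) hθ0.le
    rw [← mul_pow]
    exact exp_le_one_add_add_sq (by linarith)
  have hi1 : Integrable (fun ω => θ * u ω) P := (hu.integrable one_le_two).const_mul θ
  have hi2 : Integrable (fun ω => θ ^ 2 * u ω ^ 2) P := hu.integrable_sq.const_mul _
  have hi0 : Integrable (fun ω => 1 + θ * u ω) P := (integrable_const 1).add hi1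
  calc ∫ ω, Real.exp (θ * u ω) ∂P
      ≤ ∫ ω, (1 + θ * u ω + θ ^ 2 * u ω ^ 2) ∂P :=
        integral_mono_of_nonneg (Eventually.of_forall fun ω => (Real.exp_pos _).le)
          (hi0.add hi2) (Eventually.of_forall hle)
    _ = 1 - θ * d + θ ^ 2 * V := by
        rw [integral_add hi0 hi2, integral_add (integrable_const _) hi1, integral_const_mul,
          integral_const_mul]
        simp [hd, hV]
    _ < 1 := by nlinarith [mul_pos hθ0 hd0]

theorem exists_nat_integral_excess_sq_le {ζ : Ω → ℝ} (hζ : MemLp ζ 2 P) {ε : ℝ} (hε : 0 < ε) :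
    ∃ K : ℕ, ∫ ω, max 0 (ζ ω - K) ^ 2 ∂P ≤ ε := by
  have h : Tendsto (fun K : ℕ => ∫ ω, max 0 (ζ ω - K) ^ 2 ∂P) atTop (𝓝 (∫ _, (0 : ℝ) ∂P)) := by
    refine tendsto_integral_of_dominated_convergence (fun ω => ζ ω ^ 2) (fun K => ?_)
      hζ.integrable_sq (fun K => Eventually.of_forall fun ω => ?_)
      (Eventually.of_forall fun ω => ?_)
    · exact ((aemeasurable_const.max
        (hζ.aemeasurable.sub aemeasurable_const)).pow_const 2).aestronglyMeasurable
    · rw [Real.norm_eq_abs, abs_of_nonneg (sq_nonneg _)]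
      have hK : (0 : ℝ) ≤ K := K.cast_nonneg
      rcases max_cases 0 (ζ ω - K) with h | h <;> rw [h.1] <;> nlinarith
    · refine tendsto_const_nhds.congr' ?_
      filter_upwards [eventually_ge_atTop ⌈ζ ω⌉₊] with K hK
      rw [max_eq_left (by linarith [Nat.ceil_le.1 hK])]
      simp
  rw [integral_zero] at h
  obtain ⟨K, hK⟩ := (h.eventually (gt_mem_nhds hε)).exists
  exact ⟨K, hK.le⟩

/-- The second moment of a reflected random walk with negative drift and square-integrable
increments grows slower than linearly, uniformly over the copies of the walk. -/
theorem exists_forall_integral_reflectedWalk_sq_le [IsProbabilityMeasure P] {ζ : Ω → ℝ}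
    (hζ : MemLp ζ 2 P) (hneg : ∫ ω, ζ ω ∂P < 0) {ε : ℝ} (hε : 0 < ε) :
    ∃ N : ℕ, ∀ n ≥ N, ∀ z : ℕ → Ω → ℝ, iIndepFun z P → (∀ i, IdentDistrib (z i) ζ P P) →
      ∫ ω, reflectedWalk (fun i => z i ω) n ^ 2 ∂P ≤ ε * n := by
  obtain ⟨K, hK⟩ := exists_nat_integral_excess_sq_le hζ (by positivity : 0 < ε / 4)
  set e : Ω → ℝ := fun ω => max 0 (ζ ω - K) with he
  have heL : MemLp e 2 P := (memLp_const (0 : ℝ)).sup (hζ.sub (memLp_const (K : ℝ)))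
  set c := ∫ ω, e ω ∂P with hc
  have hc0 : 0 ≤ c := integral_nonneg fun ω => le_max_left _ _
  -- Shifting by `c` makes `w` centred, so `u` keeps the negative mean of ζ while being bounded
  -- above.
  set u : ℝ → ℝ := fun x => min x K + c with hu
  set w : ℝ → ℝ := fun x => max 0 (x - K) - c with hw
  have humeas : Measurable u := by fun_prop
  have hwmeas : Measurable w := by fun_prop
  have huw : ∀ x, u x + w x = x := fun x => by
    rcases le_total x K with h | h
    · simp [hu, hw, h]
    · simp [hu, hw, h]
  have hwL : MemLp (fun ω => w (ζ ω)) 2 P := heL.sub (memLp_const c)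
  have huL : MemLp (fun ω => u (ζ ω)) 2 P :=
    (hζ.inf (memLp_const (K : ℝ))).add (memLp_const c)
  have huK : ∀ x, u x ≤ K + c := fun x => by linarith [min_le_right x (K : ℝ)]
  have hwmean : ∫ ω, w (ζ ω) ∂P = 0 := by
    have : ∫ ω, (e ω - c) ∂P = 0 := by
      rw [integral_sub (heL.integrable one_le_two) (integrable_const c)]
      simp [hc]
    exact this
  have humean : ∫ ω, u (ζ ω) ∂P < 0 := by
    have h : ∫ ω, (u (ζ ω) + w (ζ ω)) ∂P = ∫ ω, u (ζ ω) ∂P + ∫ ω, w (ζ ω) ∂P :=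
      integral_add (huL.integrable one_le_two) (hwL.integrable one_le_two)
    simp only [huw] at h
    linarith
  have hwsq : ∫ ω, w (ζ ω) ^ 2 ∂P ≤ ε / 4 := by
    have hI2 : Integrable (fun ω => 2 * c * e ω) P := (heL.integrable one_le_two).const_mul _
    have h : ∫ ω, w (ζ ω) ^ 2 ∂P = ∫ ω, (e ω ^ 2 - 2 * c * e ω + c ^ 2) ∂P :=
      integral_congr_ae (Eventually.of_forall fun ω => by simp only [hw, he]; ring)
    rw [h, integral_add (f := fun ω => e ω ^ 2 - 2 * c * e ω) (heL.integrable_sq.sub hI2)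
      (integrable_const _), integral_sub heL.integrable_sq hI2, integral_const_mul, ← hc]
    simp only [integral_const, probReal_univ, one_smul]
    nlinarith
  obtain ⟨θ, hθ, hexp⟩ := exists_pos_integral_exp_lt_one huL (by positivity : (0 : ℝ) ≤ K + c)
    (fun ω => huK _) humean
  set ρ := ∫ ω, Real.exp (θ * u (ζ ω)) ∂P with hρ
  set C := 2 / θ ^ 2 * (1 - ρ)⁻¹ with hC
  -- Beyond `N`, the constant 2C is at most nε/2; the part from `w` supplies the other nε/2.
  obtain ⟨N, hN⟩ := exists_nat_ge (4 * C / ε)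
  refine ⟨N, fun n hn z hind hident => ?_⟩
  have hzu : ∀ i, IdentDistrib (fun ω => u (z i ω)) (fun ω => u (ζ ω)) P P :=
    fun i => (hident i).comp humeas
  have hzw : ∀ i, IdentDistrib (fun ω => w (z i ω)) (fun ω => w (ζ ω)) P P :=
    fun i => (hident i).comp hwmeas
  have hzuL : ∀ i, MemLp (fun ω => u (z i ω)) 2 P := fun i => (hzu i).memLp_iff.2 huL
  have hzwL : ∀ i, MemLp (fun ω => w (z i ω)) 2 P := fun i => (hzw i).memLp_iff.2 hwL
  have hW : ∫ ω, reflectedWalk (fun i => w (z i ω)) n ^ 2 ∂P ≤ n * (ε / 4) := by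
    refine integral_reflectedWalk_sq_le (z := fun i ω => w (z i ω))
      (hind.comp (fun _ => w) fun _ => hwmeas) hzwL (fun i => ?_) (fun i => ?_) n
    · exact ((hzw i).integral_eq.trans hwmean).le
    · exact ((hzw i).sq.integral_eq).le.trans hwsq
  have hU : ∫ ω, reflectedWalk (fun i => u (z i ω)) n ^ 2 ∂P ≤ C := by
    obtain ⟨hI, hle⟩ := integral_exp_reflectedWalk_le (z := fun i ω => u (z i ω))
      (hind.comp (fun _ => u) fun _ => humeas) (fun i => (hzuL i).aemeasurable)
      (by positivity : (0 : ℝ) ≤ K + c) (fun i ω => huK _) hθ.le hexp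
      (fun i => ((hzu i).comp (u := fun x => Real.exp (θ * x)) (by fun_prop)).integral_eq.le) n
    calc ∫ ω, reflectedWalk (fun i => u (z i ω)) n ^ 2 ∂P
        ≤ ∫ ω, 2 / θ ^ 2 * Real.exp (θ * reflectedWalk (fun i => u (z i ω)) n) ∂P := by
          refine integral_mono (memLp_reflectedWalk hzuL n).integrable_sq (hI.const_mul _)
            fun ω => ?_
          have h0 := reflectedWalk_nonneg (fun i => u (z i ω)) n
          have h1 := Real.quadratic_le_exp_of_nonneg (mul_nonneg hθ.le h0)
          have h2 := mul_nonneg hθ.le h0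
          change reflectedWalk (fun i => u (z i ω)) n ^ 2 ≤ _
          rw [div_mul_eq_mul_div, le_div_iff₀ (by positivity)]
          nlinarith
      _ = 2 / θ ^ 2 * ∫ ω, Real.exp (θ * reflectedWalk (fun i => u (z i ω)) n) ∂P :=
          integral_const_mul _ _
      _ ≤ C := by rw [hC]; gcongr
  have hU2 := (memLp_reflectedWalk hzuL n).integrable_sq
  have hW2 := (memLp_reflectedWalk hzwL n).integrable_sq
  have hsum : ∫ ω, reflectedWalk (fun i => z i ω) n ^ 2 ∂P
      ≤ 2 * C + 2 * (n * (ε / 4)) := by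
    calc ∫ ω, reflectedWalk (fun i => z i ω) n ^ 2 ∂P
        ≤ ∫ ω, (2 * reflectedWalk (fun i => u (z i ω)) n ^ 2
            + 2 * reflectedWalk (fun i => w (z i ω)) n ^ 2) ∂P := by
          refine integral_mono
            (memLp_reflectedWalk (fun i => (hident i).memLp_iff.2 hζ) n).integrable_sq
            ((hU2.const_mul 2).add (hW2.const_mul 2)) fun ω => ?_
          have h := reflectedWalk_add_le (fun i => u (z i ω)) (fun i => w (z i ω)) n
          simp only [huw] at h
          have h0 := reflectedWalk_nonneg (fun i => z i ω) n
          change reflectedWalk (fun i => z i ω) n ^ 2 ≤ 2 * _ ^ 2 + 2 * _ ^ 2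
          nlinarith [sq_nonneg (reflectedWalk (fun i => u (z i ω)) n
            - reflectedWalk (fun i => w (z i ω)) n)]
      _ = 2 * ∫ ω, reflectedWalk (fun i => u (z i ω)) n ^ 2 ∂P
            + 2 * ∫ ω, reflectedWalk (fun i => w (z i ω)) n ^ 2 ∂P := by
          rw [integral_add (hU2.const_mul 2) (hW2.const_mul 2), integral_const_mul,
            integral_const_mul]
      _ ≤ _ := by gcongr
  have hn' : 4 * C / ε ≤ n := hN.trans (by exact_mod_cast hn)
  rw [div_le_iff₀ hε] at hn'
  linarith

end Probability

/-! ### Geometry: the diameter bounded by reflected walks -/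

/-- If b ≤ 2δa, the cross term 2δab of (a + δb)² already covers b². Otherwise c is at least the
excess b - 2δa, and the right-hand base is at least (1 - 2δ)a + (1 + δ)b. -/
theorem add_sq_le_sq_of_sub_le {a b c δ : ℝ} (ha : 0 ≤ a) (hb : 0 ≤ b) (hc : 0 ≤ c) (hδ : 0 ≤ δ)
    (hδ2 : δ ≤ 1 / 2) (h : b - 2 * δ * a ≤ c) : a ^ 2 + b ^ 2 ≤ (a + δ * b + c) ^ 2 := by
  have hδb := mul_nonneg hδ hb
  rcases le_total b (2 * δ * a) with hab | hab
  · have h1 : (a + δ * b) ^ 2 ≤ (a + δ * b + c) ^ 2 :=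
      pow_le_pow_left₀ (by positivity) (by linarith) 2
    nlinarith [mul_le_mul_of_nonneg_right hab hb, sq_nonneg (δ * b)]
  · have h0 : 0 ≤ (1 - 2 * δ) * a + (1 + δ) * b := by
      have : 0 ≤ 1 - 2 * δ := by linarith
      positivity
    have h1 : ((1 - 2 * δ) * a + (1 + δ) * b) ^ 2 ≤ (a + δ * b + c) ^ 2 :=
      pow_le_pow_left₀ h0 (by linarith) 2
    have h2 := mul_le_mul_of_nonneg_left hab (mul_nonneg hδ hb)
    have h3 := mul_le_mul_of_nonneg_left hab (mul_nonneg (mul_nonneg hδ hδ) ha)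
    have h4 : 0 ≤ (1 - 2 * δ) * (1 + δ) * a := by
      have : 0 ≤ 1 - 2 * δ := by linarith
      positivity
    have h5 := mul_le_mul_of_nonneg_left hab h4
    nlinarith [sq_nonneg (δ * b)]

/-- The rotation of a plane vector by a right angle. -/
noncomputable def rotate (u : Plane) : Plane := !₂[-u 1, u 0]

theorem inner_rotate_self (u : Plane) : inner ℝ (rotate u) u = 0 := by
  simp [rotate, PiLp.inner_apply, Fin.sum_univ_two]
  ring

theorem norm_sq_eq_inner_sq_add_inner_rotate_sq {u : Plane} (hu : ‖u‖ = 1) (v : Plane) :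
    ‖v‖ ^ 2 = inner ℝ u v ^ 2 + inner ℝ (rotate u) v ^ 2 := by
  have h : u 0 ^ 2 + u 1 ^ 2 = 1 := by
    have := EuclideanSpace.real_norm_sq_eq u
    rw [hu, Fin.sum_univ_two] at this
    linarith
  rw [EuclideanSpace.real_norm_sq_eq]
  simp only [rotate, PiLp.inner_apply, Fin.sum_univ_two, RCLike.inner_apply, conj_trivial]
  simp
  linear_combination -(v 0 ^ 2 + v 1 ^ 2) * h

/-- The involution of `ℕ` reversing `0, …, n - 1` and fixing the other numbers. -/
def reverseBelow (n i : ℕ) : ℕ := if i < n then n - 1 - i else i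

/-- Injectivity on all of ℕ is what keeps the reindexed increments independent. -/
theorem reverseBelow_injective (n : ℕ) : Function.Injective (reverseBelow n) := by
  intro i j h
  unfold reverseBelow at h
  split_ifs at h <;> omega

/-- Reversing time turns initial sums into final ones; this controls how far the path goes behind
its start. -/
theorem sum_range_le_reflectedWalk_reverse (z : ℕ → ℝ) {k n : ℕ} (hkn : k ≤ n) :
    ∑ i ∈ Finset.range k, z i ≤ reflectedWalk (fun i => z (reverseBelow n i)) n := by
  refine le_trans (le_of_eq ?_) (sum_Ico_le_reflectedWalk _ (Nat.sub_le n k))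
  refine Finset.sum_bij' (fun i _ => n - 1 - i) (fun i _ => n - 1 - i) ?_ ?_ ?_ ?_ ?_
  · intro i hi; simp only [Finset.mem_range, Finset.mem_Ico] at *; omega
  · intro i hi; simp only [Finset.mem_range, Finset.mem_Ico] at *; omega
  · intro i hi; simp only [Finset.mem_range] at *; omega
  · intro i hi; simp only [Finset.mem_Ico] at *; omega
  · intro i hi
    simp only [Finset.mem_range] at hi
    congr 1
    unfold reverseBelow
    split_ifs <;> omega

/-- The reflection at `0` of the walk with increments `v i` projected in the direction `a`. -/
noncomputable def projWalk (a : Plane) (v : ℕ → Plane) (n : ℕ) : ℝ :=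
  reflectedWalk (fun i => inner ℝ a (v i)) n

theorem projWalk_nonneg (a : Plane) (v : ℕ → Plane) (n : ℕ) : 0 ≤ projWalk a v n :=
  reflectedWalk_nonneg _ _

theorem inner_sum_range_sub_le_projWalk (a : Plane) (v : ℕ → Plane) {k n : ℕ} (hkn : k ≤ n) :
    inner ℝ a (∑ i ∈ Finset.range n, v i) - inner ℝ a (∑ i ∈ Finset.range k, v i)
      ≤ projWalk a v n := by
  rw [← inner_sub_right, ← Finset.sum_Ico_eq_sub _ hkn, inner_sum]
  exact sum_Ico_le_reflectedWalk _ hkn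

theorem inner_sum_range_le_projWalk_reverse (a : Plane) (v : ℕ → Plane) {k n : ℕ} (hkn : k ≤ n) :
    inner ℝ a (∑ i ∈ Finset.range k, v i) ≤ projWalk a (fun i => v (reverseBelow n i)) n := by
  rw [inner_sum]
  exact sum_range_le_reflectedWalk_reverse (fun i => inner ℝ a (v i)) hkn

/-- A bound for how far the diameter of the path with increments `v` exceeds its displacement in
the direction `u`. -/
noncomputable def excessBound (u : Plane) (δ : ℝ) (v : ℕ → Plane) (n : ℕ) : ℝ :=
  projWalk (-u) (fun i => v (reverseBelow n i)) n + projWalk (-u) v n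
    + δ * (projWalk (rotate u) v n + projWalk (-rotate u) v n)
    + (projWalk (rotate u - δ • u) v n + projWalk (-rotate u - δ • u) v n)

theorem dist_sum_range_le {u : Plane} (hu : ‖u‖ = 1) {δ : ℝ} (hδ : 0 ≤ δ) (hδ2 : δ ≤ 1 / 2)
    (v : ℕ → Plane) {i j n : ℕ} (hi : i ≤ n) (hj : j ≤ n) :
    dist (∑ k ∈ Finset.range i, v k) (∑ k ∈ Finset.range j, v k)
      ≤ inner ℝ u (∑ k ∈ Finset.range n, v k) + excessBound u δ v n := by
  set s : ℕ → Plane := fun m => ∑ k ∈ Finset.range m, v k with hs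
  set x : ℕ → ℝ := fun m => inner ℝ u (s m) with hx
  set y : ℕ → ℝ := fun m => inner ℝ (rotate u) (s m) with hy
  set A := projWalk (-u) (fun i => v (reverseBelow n i)) n with hA
  set B := projWalk (-u) v n with hB
  set C := projWalk (rotate u) v n with hC
  set C' := projWalk (-rotate u) v n with hC'
  set E := projWalk (rotate u - δ • u) v n with hE
  set E' := projWalk (-rotate u - δ • u) v n with hE'
  have hAx : ∀ k ≤ n, -x k ≤ A := fun k hk => by
    simpa [inner_neg_left] using inner_sum_range_le_projWalk_reverse (-u) v hk
  have hBx : ∀ k ≤ n, x k - x n ≤ B := fun k hk => by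
    have := inner_sum_range_sub_le_projWalk (-u) v hk
    simp only [inner_neg_left] at this
    simp only [hx, hs]; linarith
  have hCy : ∀ k ≤ n, y n - y k ≤ C := fun k hk =>
    inner_sum_range_sub_le_projWalk (rotate u) v hk
  have hCy' : ∀ k ≤ n, y k - y n ≤ C' := fun k hk => by
    have := inner_sum_range_sub_le_projWalk (-rotate u) v hk
    simp only [inner_neg_left] at this
    simp only [hy, hs]; linarith
  have hEy : ∀ k ≤ n, (y n - y k) - δ * (x n - x k) ≤ E := fun k hk => by
    have := inner_sum_range_sub_le_projWalk (rotate u - δ • u) v hk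
    simp only [inner_sub_left, real_inner_smul_left] at this
    simp only [hx, hy, hs]; linarith
  have hEy' : ∀ k ≤ n, (y k - y n) - δ * (x n - x k) ≤ E' := fun k hk => by
    have := inner_sum_range_sub_le_projWalk (-rotate u - δ • u) v hk
    simp only [inner_sub_left, inner_neg_left, real_inner_smul_left] at this
    simp only [hx, hy, hs]; linarith
  have hB0 : 0 ≤ B := projWalk_nonneg _ _ _
  have hE0 : 0 ≤ E := projWalk_nonneg _ _ _
  have hE0' : 0 ≤ E' := projWalk_nonneg _ _ _
  -- All x-coordinates lie in [-A, x_n + B], an interval of length a.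
  set a := A + B + x n with ha
  set b := |y i - y j| with hb
  have hxa : |x i - x j| ≤ a := abs_le.2
    ⟨by linarith [hAx i hi, hBx j hj], by linarith [hAx j hj, hBx i hi]⟩
  have hbC : b ≤ C + C' := abs_le.2
    ⟨by linarith [hCy i hi, hCy' j hj], by linarith [hCy j hj, hCy' i hi]⟩
  have hδx : ∀ k ≤ n, δ * (x n - x k) ≤ δ * a := fun k hk =>
    mul_le_mul_of_nonneg_left (by linarith [hAx k hk]) hδ
  have hbE : b - 2 * δ * a ≤ E + E' := by
    have : b ≤ E + E' + 2 * (δ * a) := abs_le.2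
      ⟨by linarith [hEy i hi, hEy' j hj, hδx i hi, hδx j hj],
        by linarith [hEy j hj, hEy' i hi, hδx i hi, hδx j hj]⟩
    linarith
  have ha0 : 0 ≤ a := (abs_nonneg _).trans hxa
  have hb0 : 0 ≤ b := abs_nonneg _
  have hmain := add_sq_le_sq_of_sub_le ha0 hb0 (add_nonneg hE0 hE0') hδ hδ2 hbE
  have hdist : dist (s i) (s j) ^ 2 = (x i - x j) ^ 2 + b ^ 2 := by
    rw [dist_eq_norm, norm_sq_eq_inner_sq_add_inner_rotate_sq hu, inner_sub_right,
      inner_sub_right, hb, sq_abs]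
  have hle : dist (s i) (s j) ≤ a + δ * b + (E + E') := by
    refine abs_le_of_sq_le_sq' ?_ (by positivity) |>.2
    rw [hdist]
    have := sq_le_sq' (abs_le.1 hxa).1 (abs_le.1 hxa).2
    linarith
  have := mul_le_mul_of_nonneg_left hbC hδ
  change dist (s i) (s j) ≤ x n + (A + B + δ * (C + C') + (E + E'))
  linarith

/-! ### Pathwise bounds and measurability for the diameter -/

theorem isBounded_walk_image {Ω : Type*} (X : ℕ → Ω → Plane) (n : ℕ) (ω : Ω) :
    Bornology.IsBounded ((fun k => walk X k ω) '' Set.Iic n) :=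
  ((Set.finite_Iic n).image _).isBounded

theorem inner_walk_le_walkDiam {Ω : Type*} (X : ℕ → Ω → Plane) {u : Plane} (hu : ‖u‖ = 1)
    (n : ℕ) (ω : Ω) : inner ℝ (walk X n ω) u ≤ walkDiam X n ω := by
  rw [walkDiam_eq]
  have h := Metric.dist_le_diam_of_mem (isBounded_walk_image X n ω)
    (Set.mem_image_of_mem _ (Set.mem_Iic.2 le_rfl))
    (Set.mem_image_of_mem _ (Set.mem_Iic.2 n.zero_le))
  have h2 := real_inner_le_norm (walk X n ω) u
  have h0 : walk X 0 ω = 0 := by simp [walk]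
  rw [h0, dist_zero_right] at h
  rw [hu, mul_one] at h2
  exact h2.trans h

theorem walkDiam_sub_inner_le {Ω : Type*} (X : ℕ → Ω → Plane) {u : Plane} (hu : ‖u‖ = 1)
    {δ : ℝ} (hδ : 0 ≤ δ) (hδ2 : δ ≤ 1 / 2) (n : ℕ) (ω : Ω) :
    walkDiam X n ω - inner ℝ (walk X n ω) u ≤ excessBound u δ (fun k => X k ω) n := by
  rw [walkDiam_eq, real_inner_comm, sub_le_iff_le_add']
  refine Metric.diam_le_of_forall_dist_le_of_nonempty ⟨_, Set.mem_image_of_mem _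
    (Set.mem_Iic.2 le_rfl)⟩ ?_
  rintro _ ⟨i, hi, rfl⟩ _ ⟨j, hj, rfl⟩
  exact dist_sum_range_le hu hδ hδ2 (fun k => X k ω) hi hj

theorem walkDiam_eq_sup' {Ω : Type*} (X : ℕ → Ω → Plane) (n : ℕ) (ω : Ω) :
    walkDiam X n ω = (Finset.range (n + 1) ×ˢ Finset.range (n + 1)).sup' ⟨(0, 0), by simp⟩
      (fun p => dist (walk X p.1 ω) (walk X p.2 ω)) := by
  rw [walkDiam_eq]
  refine le_antisymm ?_ (Finset.sup'_le _ _ fun p hp => ?_)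
  · refine Metric.diam_le_of_forall_dist_le_of_nonempty ⟨_, Set.mem_image_of_mem _
      (Set.mem_Iic.2 le_rfl)⟩ ?_
    rintro _ ⟨i, hi, rfl⟩ _ ⟨j, hj, rfl⟩
    exact Finset.le_sup' (fun p : ℕ × ℕ => dist (walk X p.1 ω) (walk X p.2 ω))
      (b := (i, j)) (by simpa [Nat.lt_succ_iff] using And.intro hi hj)
  · rw [Finset.mem_product, Finset.mem_range_succ_iff, Finset.mem_range_succ_iff] at hp
    exact Metric.dist_le_diam_of_mem (isBounded_walk_image X n ω)
      (Set.mem_image_of_mem _ hp.1) (Set.mem_image_of_mem _ hp.2)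

theorem measurable_walk {Ω : Type*} [MeasurableSpace Ω] {X : ℕ → Ω → Plane}
    (hX : ∀ k, Measurable (X k)) (n : ℕ) : Measurable (walk X n) :=
  Finset.measurable_fun_sum _ fun k _ => hX k

theorem measurable_walkDiam {Ω : Type*} [MeasurableSpace Ω] {X : ℕ → Ω → Plane}
    (hX : ∀ k, Measurable (X k)) (n : ℕ) : Measurable (walkDiam X n) := by
  rw [funext (walkDiam_eq_sup' X n)]
  have := Finset.measurable_sup' (s := Finset.range (n + 1) ×ˢ Finset.range (n + 1))
    (f := fun p ω => dist (walk X p.1 ω) (walk X p.2 ω)) ⟨(0, 0), by simp⟩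
    fun p _ => (measurable_walk hX p.1).dist (measurable_walk hX p.2)
  convert this using 1
  ext ω
  exact (Finset.sup'_apply (C := fun _ : Ω => ℝ) _
    (fun (p : ℕ × ℕ) ω => dist (walk X p.1 ω) (walk X p.2 ω)) ω).symm

theorem aemeasurable_walkDiam_sub_inner {Ω : Type*} [MeasurableSpace Ω] {P : Measure Ω}
    {X : ℕ → Ω → Plane} (hX : ∀ k, AEMeasurable (X k) P) (u : Plane) (n : ℕ) :
    AEMeasurable (fun ω => walkDiam X n ω - inner ℝ (walk X n ω) u) P := by
  -- The increments are only a.e. measurable, so measurability is proved on path space and then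
  -- pulled back.
  have h : Measurable fun v : ℕ → Plane =>
      walkDiam (fun k (v : ℕ → Plane) => v k) n v
        - inner ℝ (walk (fun k (v : ℕ → Plane) => v k) n v) u :=
    (measurable_walkDiam measurable_pi_apply n).sub
      ((measurable_walk measurable_pi_apply n).inner measurable_const)
  exact h.comp_aemeasurable (aemeasurable_pi_lambda (fun ω k => X k ω) hX)

/-! ### Second moments of the excess -/

section Moments

variable {Ω : Type*} [MeasurableSpace Ω] {P : Measure Ω}

theorem memLp_projWalk [IsFiniteMeasure P] {X : ℕ → Ω → Plane} (hX : ∀ k, MemLp (X k) 2 P)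
    (a : Plane) (n : ℕ) : MemLp (fun ω => projWalk a (fun k => X k ω) n) 2 P :=
  memLp_reflectedWalk (fun k => (hX k).const_inner a) n

theorem integral_projWalk_sq_le [IsProbabilityMeasure P] {Z : Ω → Plane} {X : ℕ → Ω → Plane}
    (hZ : MemLp Z 2 P) (hindep : iIndepFun X P) (hident : ∀ k, IdentDistrib (X k) Z P P)
    {a : Plane} (ha : inner ℝ a (∫ ω, Z ω ∂P) = 0) (n : ℕ) :
    ∫ ω, projWalk a (fun k => X k ω) n ^ 2 ∂P ≤ n * ∫ ω, inner ℝ a (Z ω) ^ 2 ∂P := by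
  have hm : Measurable fun x : Plane => inner ℝ a x := by fun_prop
  have hid : ∀ k, IdentDistrib (fun ω => inner ℝ a (X k ω)) (fun ω => inner ℝ a (Z ω)) P P :=
    fun k => (hident k).comp hm
  refine integral_reflectedWalk_sq_le (z := fun k ω => inner ℝ a (X k ω))
    (hindep.comp (fun _ x => inner ℝ a x) fun _ => hm)
    (fun k => (hid k).memLp_iff.2 (hZ.const_inner a)) (fun k => ?_)
    (fun k => (hid k).sq.integral_eq.le) n
  rw [(hid k).integral_eq, integral_inner (hZ.integrable one_le_two), ha]

theorem exists_forall_integral_projWalk_sq_le [IsProbabilityMeasure P] {Z : Ω → Plane}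
    (hZ : MemLp Z 2 P) {a : Plane} (ha : inner ℝ a (∫ ω, Z ω ∂P) < 0) {ε : ℝ} (hε : 0 < ε) :
    ∃ N : ℕ, ∀ n ≥ N, ∀ X : ℕ → Ω → Plane, iIndepFun X P → (∀ k, IdentDistrib (X k) Z P P) →
      ∫ ω, projWalk a (fun k => X k ω) n ^ 2 ∂P ≤ ε * n := by
  have hm : Measurable fun x : Plane => inner ℝ a x := by fun_prop
  obtain ⟨N, hN⟩ := exists_forall_integral_reflectedWalk_sq_le (hZ.const_inner a)
    (by rwa [integral_inner (hZ.integrable one_le_two)]) hε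
  exact ⟨N, fun n hn X hind hident => hN n hn (fun k ω => inner ℝ a (X k ω))
    (hind.comp (fun _ x => inner ℝ a x) fun _ => hm) fun k => (hident k).comp hm⟩

theorem memLp_excessBound [IsFiniteMeasure P] {X : ℕ → Ω → Plane} (hX : ∀ k, MemLp (X k) 2 P)
    (u : Plane) (δ : ℝ) (n : ℕ) : MemLp (fun ω => excessBound u δ (fun k => X k ω) n) 2 P :=
  (((memLp_projWalk (fun k => hX (reverseBelow n k)) (-u) n).add (memLp_projWalk hX (-u) n)).add
    (((memLp_projWalk hX (rotate u) n).add (memLp_projWalk hX (-rotate u) n)).const_mul δ)).add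
    ((memLp_projWalk hX _ n).add (memLp_projWalk hX _ n))

theorem memLp_walkDiam_sub_inner [IsFiniteMeasure P] {X : ℕ → Ω → Plane}
    (hX : ∀ k, MemLp (X k) 2 P) {u : Plane} (hu : ‖u‖ = 1) (n : ℕ) :
    MemLp (fun ω => walkDiam X n ω - inner ℝ (walk X n ω) u) 2 P := by
  -- Any admissible δ gives a square-integrable majorant; 0 is the simplest.
  refine (memLp_excessBound hX u 0 n).mono'
    (aemeasurable_walkDiam_sub_inner (fun k => (hX k).aemeasurable) u n).aestronglyMeasurable
    (Eventually.of_forall fun ω => ?_)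
  rw [Real.norm_eq_abs, abs_of_nonneg (sub_nonneg.2 (inner_walk_le_walkDiam X hu n ω))]
  exact walkDiam_sub_inner_le X hu le_rfl (by norm_num) n ω

theorem integral_excessBound_sq_le [IsFiniteMeasure P] {X : ℕ → Ω → Plane}
    (hX : ∀ k, MemLp (X k) 2 P) (u : Plane) (δ : ℝ) (n : ℕ) :
    ∫ ω, excessBound u δ (fun k => X k ω) n ^ 2 ∂P ≤
      6 * (∫ ω, projWalk (-u) (fun k => X (reverseBelow n k) ω) n ^ 2 ∂P
        + ∫ ω, projWalk (-u) (fun k => X k ω) n ^ 2 ∂P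
        + δ ^ 2 * (∫ ω, projWalk (rotate u) (fun k => X k ω) n ^ 2 ∂P
          + ∫ ω, projWalk (-rotate u) (fun k => X k ω) n ^ 2 ∂P)
        + (∫ ω, projWalk (rotate u - δ • u) (fun k => X k ω) n ^ 2 ∂P
          + ∫ ω, projWalk (-rotate u - δ • u) (fun k => X k ω) n ^ 2 ∂P)) := by
  have hI := fun a : Plane => (memLp_projWalk hX a n).integrable_sq
  have h1 := (memLp_projWalk (fun k => hX (reverseBelow n k)) (-u) n).integrable_sq
  have hadd : ∀ {f g : Ω → ℝ}, Integrable f P → Integrable g P →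
      Integrable (fun ω => f ω + g ω) P := fun hf hg => hf.add hg
  have h2 := hadd h1 (hI (-u))
  have h3 := (hadd (hI (rotate u)) (hI (-rotate u))).const_mul (δ ^ 2)
  have h4 := hadd (hI (rotate u - δ • u)) (hI (-rotate u - δ • u))
  rw [← integral_add h1 (hI _), ← integral_add (hI _) (hI _), ← integral_const_mul,
    ← integral_add h2 h3, ← integral_add (hI _) (hI _), ← integral_add (hadd h2 h3) h4,
    ← integral_const_mul]
  refine integral_mono (memLp_excessBound hX u δ n).integrable_sq
    (((h2.add h3).add h4).const_mul 6) fun ω => ?_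
  simp only [excessBound]
  generalize projWalk (-u) (fun k => X (reverseBelow n k) ω) n = a
  generalize projWalk (-u) (fun k => X k ω) n = b
  generalize projWalk (rotate u) (fun k => X k ω) n = c
  generalize projWalk (-rotate u) (fun k => X k ω) n = d
  generalize projWalk (rotate u - δ • u) (fun k => X k ω) n = e
  generalize projWalk (-rotate u - δ • u) (fun k => X k ω) n = f
  have := sq_sum_le_card_mul_sum_sq (s := Finset.univ) (f := ![a, b, δ * c, δ * d, e, f])
  simp [Fin.sum_univ_succ] at this
  nlinarith

theorem eventually_integral_sq_walkDiam_sub_inner_le [IsProbabilityMeasure P] {Z : Ω → Plane}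
    {X : ℕ → Ω → Plane} (hZ : MemLp Z 2 P) (hindep : iIndepFun X P)
    (hident : ∀ k, IdentDistrib (X k) Z P P) {u : Plane} (hu : ‖u‖ = 1) {m : ℝ} (hm : 0 < m)
    (hmean : ∫ ω, Z ω ∂P = m • u) {ε : ℝ} (hε : 0 < ε) :
    ∀ᶠ n : ℕ in atTop,
      ∫ ω, (walkDiam X n ω - inner ℝ (walk X n ω) u) ^ 2 ∂P ≤ ε * n := by
  have hX : ∀ k, MemLp (X k) 2 P := fun k => (hident k).memLp_iff.2 hZ
  have huu : inner ℝ u u = (1 : ℝ) := by rw [real_inner_self_eq_norm_sq, hu, one_pow]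
  have hrot := inner_rotate_self u
  set V := ∫ ω, inner ℝ (rotate u) (Z ω) ^ 2 ∂P + ∫ ω, inner ℝ (-rotate u) (Z ω) ^ 2 ∂P with hV
  have hV0 : 0 ≤ V := add_nonneg (integral_nonneg fun _ => sq_nonneg _)
    (integral_nonneg fun _ => sq_nonneg _)
  obtain ⟨δ, hδ0, hδ2, hδV⟩ : ∃ δ : ℝ, 0 < δ ∧ δ ≤ 1 / 2 ∧ δ ^ 2 * V ≤ ε / 12 := by
    refine ⟨min (1 / 2) (ε / (12 * (V + 1))), by positivity, min_le_left _ _, ?_⟩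
    set δ := min (1 / 2) (ε / (12 * (V + 1))) with hδ
    have h0 : 0 < δ := by positivity
    have h1 : δ ≤ 1 / 2 := min_le_left _ _
    have h2 : δ * (12 * (V + 1)) ≤ ε := (le_div_iff₀ (by positivity)).1 (min_le_right _ _)
    nlinarith [mul_nonneg h0.le hV0]
  -- Four negative-drift terms at ε/48 and the δ² term at ε/12 sum to ε/6, matching the factor 6
  -- from Cauchy–Schwarz.
  have hε' : 0 < ε / 48 := by positivity
  obtain ⟨N₁, h₁⟩ := exists_forall_integral_projWalk_sq_le hZ (a := -u)
    (by rw [hmean, inner_smul_right, inner_neg_left, huu]; linarith) hε'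
  obtain ⟨N₂, h₂⟩ := exists_forall_integral_projWalk_sq_le hZ (a := rotate u - δ • u)
    (by rw [hmean, inner_smul_right, inner_sub_left, real_inner_smul_left, huu, hrot]
        linarith [mul_pos hm hδ0]) hε'
  obtain ⟨N₃, h₃⟩ := exists_forall_integral_projWalk_sq_le hZ (a := -rotate u - δ • u)
    (by rw [hmean, inner_smul_right, inner_sub_left, inner_neg_left,
          real_inner_smul_left, huu, hrot]
        linarith [mul_pos hm hδ0]) hε'
  filter_upwards [eventually_ge_atTop N₁, eventually_ge_atTop N₂, eventually_ge_atTop N₃]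
    with n hn₁ hn₂ hn₃
  have hle : ∫ ω, (walkDiam X n ω - inner ℝ (walk X n ω) u) ^ 2 ∂P
      ≤ ∫ ω, excessBound u δ (fun k => X k ω) n ^ 2 ∂P := by
    refine integral_mono (memLp_walkDiam_sub_inner hX hu n).integrable_sq
      (memLp_excessBound hX u δ n).integrable_sq fun ω => ?_
    exact pow_le_pow_left₀ (sub_nonneg.2 (inner_walk_le_walkDiam X hu n ω))
      (walkDiam_sub_inner_le X hu hδ0.le hδ2 n ω) 2
  -- The reversed sequence changes with n, so the threshold `N₁` has to be uniform over all copies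
  -- of the walk.
  have hA := h₁ n hn₁ (fun k => X (reverseBelow n k))
    (hindep.precomp (reverseBelow_injective n)) fun k => hident _
  have hB := h₁ n hn₁ X hindep hident
  have hC := integral_projWalk_sq_le hZ hindep hident (a := rotate u)
    (by rw [hmean, inner_smul_right, hrot, mul_zero]) n
  have hC' := integral_projWalk_sq_le hZ hindep hident (a := -rotate u)
    (by rw [hmean, inner_smul_right, inner_neg_left, hrot, neg_zero, mul_zero]) n
  have hE := h₂ n hn₂ X hindep hident
  have hE' := h₃ n hn₃ X hindep hident
  have hCC := mul_le_mul_of_nonneg_left (add_le_add hC hC') (sq_nonneg δ)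
  have hVn := mul_le_mul_of_nonneg_left hδV (Nat.cast_nonneg (α := ℝ) n)
  rw [← mul_add, ← hV] at hCC
  linarith [integral_excessBound_sq_le hX u δ n]

end Moments

/-! ### Convergence in L² -/

theorem mainTheorem10 {Ω : Type*} [MeasurableSpace Ω] (P : Measure Ω) [IsProbabilityMeasure P]
    (Z : Ω → Plane) (X : ℕ → Ω → Plane)
    (hindep : iIndepFun X P)
    (hident : ∀ k, IdentDistrib (X k) Z P P)
    (hsq : Integrable (fun ω => ‖Z ω‖ ^ 2) P)
    (μ : Plane) (hμ : μ = ∫ ω, Z ω ∂P) (hμ0 : μ ≠ 0) :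
    (∀ n : ℕ, MemLp (fun ω => (n : ℝ) ^ (-(1 / 2) : ℝ) *
        |walkDiam X n ω - inner ℝ (walk X n ω) (unitDir μ)|) 2 P) ∧
    Tendsto (fun n : ℕ => eLpNorm (fun ω => (n : ℝ) ^ (-(1 / 2) : ℝ) *
        |walkDiam X n ω - inner ℝ (walk X n ω) (unitDir μ)|) 2 P) atTop (𝓝 0) := by
  have hμpos : 0 < ‖μ‖ := norm_pos_iff.2 hμ0
  have hu : ‖unitDir μ‖ = 1 := by
    rw [unitDir, norm_smul, norm_inv, norm_norm, inv_mul_cancel₀ hμpos.ne']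
  have hmean : ∫ ω, Z ω ∂P = ‖μ‖ • unitDir μ := by
    rw [unitDir, smul_smul, mul_inv_cancel₀ hμpos.ne', one_smul, hμ]
  have hZ : MemLp Z 2 P :=
    (memLp_two_iff_integrable_sq_norm (hident 0).aemeasurable_snd.aestronglyMeasurable).2 hsq
  have hX : ∀ k, MemLp (X k) 2 P := fun k => (hident k).memLp_iff.2 hZ
  have hmem : ∀ n : ℕ, MemLp (fun ω => (n : ℝ) ^ (-(1 / 2) : ℝ) *
      |walkDiam X n ω - inner ℝ (walk X n ω) (unitDir μ)|) 2 P := fun n =>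
    (memLp_walkDiam_sub_inner hX hu n).norm.const_mul _
  refine ⟨hmem, ?_⟩
  have hint : Tendsto (fun n : ℕ => ∫ ω, ‖(n : ℝ) ^ (-(1 / 2) : ℝ) *
      |walkDiam X n ω - inner ℝ (walk X n ω) (unitDir μ)|‖ ^ (2 : ℝ) ∂P) atTop (𝓝 0) := by
    rw [Metric.tendsto_nhds]
    intro ε hε
    filter_upwards [eventually_integral_sq_walkDiam_sub_inner_le hZ hindep hident hu hμpos hmean
      (half_pos hε), eventually_gt_atTop 0] with n hn hn0
    have hn0' : (0 : ℝ) < n := by exact_mod_cast hn0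
    have hpow : ((n : ℝ) ^ (-(1 / 2) : ℝ)) ^ 2 = (n : ℝ)⁻¹ := by
      rw [← Real.rpow_natCast, ← Real.rpow_mul hn0'.le]
      norm_num [Real.rpow_neg_one]
    have heq : ∫ ω, ‖(n : ℝ) ^ (-(1 / 2) : ℝ) *
        |walkDiam X n ω - inner ℝ (walk X n ω) (unitDir μ)|‖ ^ (2 : ℝ) ∂P
        = (n : ℝ)⁻¹ * ∫ ω, (walkDiam X n ω - inner ℝ (walk X n ω) (unitDir μ)) ^ 2 ∂P := by
      rw [← integral_const_mul]
      refine integral_congr_ae (Eventually.of_forall fun ω => ?_)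
      simp only [Real.rpow_two, Real.norm_eq_abs, sq_abs, mul_pow, hpow]
    rw [heq, Real.dist_0_eq_abs, abs_of_nonneg
      (mul_nonneg (inv_nonneg.2 hn0'.le) (integral_nonneg fun _ => sq_nonneg _)),
      inv_mul_lt_iff₀ hn0']
    nlinarith
  have h2 := hint.rpow_const (p := (2 : ℝ)⁻¹) (Or.inr (by norm_num))
  rw [Real.zero_rpow (by norm_num)] at h2
  have h3 := ENNReal.tendsto_ofReal h2
  rw [ENNReal.ofReal_zero] at h3
  refine h3.congr fun n => ?_
  rw [(hmem n).eLpNorm_eq_integral_rpow_norm two_ne_zero ENNReal.ofNat_ne_top]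
  simp only [ENNReal.toReal_ofNat]
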